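/- Let $\tau$ be a relational dictionary (a first-order vocabulary with relation symbols only, no function or constant symbols), and let $M_1, M_2$ be $\tau$-structures. Their sum $M_1\oplus M_2$ is the structure in the dictionary $\tau\cup\{L,R\}$, with $L,R$ two new unary relation symbols, whose universe is the disjoint union $|M_1|\sqcup|M_2|$, with $S^{M_1\oplus M_2}=S^{M_1}\cup S^{M_2}$ for every relation symbol $S\in\tau$, and with $L^{M_1\oplus M_2}=|M_1|$, $R^{M_1\oplus M_2}=|M_2|$. For a first-order theory $T$ and a cardinal $\kappa$, write $\kappa^{\mathrm{ict}}(T)>\kappa$ if there are a finite tuple of variables $\bar x$ and formulas $\varphi_i(\bar x,\bar y_i)$ $(i<\kappa)$, with finite tuples $\bar y_i$, such that, with fresh tuples of variables $\bar x_\eta$ $(\eta\in{}^{\kappa}\omega)$ and $\bar y_i^{\,j}$ $(i<\kappa,\ j<\omega)$, the set of formulas $$\{\varphi_i(\bar x_\eta,\bar y_i^{\,j}) : i<\kappa,\ j<\omega,\ \eta\in{}^{\kappa}\omega,\ \eta(i)=j\}\ \cup\ \{\neg\varphi_i(\bar x_\eta,\bar y_i^{\,j}) : i<\kappa,\ j<\omega,\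 \eta\in{}^{\kappa}\omega,\ \eta(i)\neq j\}$$ is consistent with $T$. Write $\kappa^{\mathrm{ict}}(T)=\kappa$ if $\kappa^{\mathrm{ict}}(T)>\lambda$ for every cardinal $\lambda<\kappa$ but not $\kappa^{\mathrm{ict}}(T)>\kappa$. The theory $T$ is called strongly dependent$^1$ if $\kappa^{\mathrm{ict}}(T)=\aleph_0$. Theorem. If the complete theories $\mathrm{Th}(M_1)$ and $\mathrm{Th}(M_2)$ are strongly dependent$^1$, then so is $\mathrm{Th}(M_1\oplus M_2)$. -/

import Mathlib

universe u v w w'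

/-- The relation symbols of the dictionary `{L, R}`: two distinct unary symbols. -/
inductive SideRel : ℕ → Type
  | left : SideRel 1
  | right : SideRel 1

/-- The dictionary `{L, R}` with two unary relation symbols and nothing else. -/
def sideLanguage : FirstOrder.Language.{0, 0} := ⟨fun _ => Empty, SideRel⟩

section Sum

/-- The structure `M + N` in the relational dictionary `L`: its universe is the disjoint union of
the universes of `M` and `N`, and each relation is the union of its interpretations in `M`
and in `N`. -/
instance structureSum (L : FirstOrder.Language.{u, v}) [L.IsRelational] (M : Type w) (N : Type w')
    [L.Structure M] [L.Structure N] : L.Structure (M ⊕ N) where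
  funMap := fun f _ => isEmptyElim f
  RelMap := fun {_} S x =>
    (∃ a, x = Sum.inl ∘ a ∧ FirstOrder.Language.Structure.RelMap (M := M) S a) ∨
      (∃ b, x = Sum.inr ∘ b ∧ FirstOrder.Language.Structure.RelMap (M := N) S b)

/-- The symbols `L` and `R` name the two parts of the disjoint union `M ⊕ N`. -/
instance sideStructure (M : Type w) (N : Type w') : sideLanguage.Structure (M ⊕ N) where
  funMap := fun f _ => Empty.elim f
  RelMap := fun {_} S =>
    match S with
    | SideRel.left => fun x => ∃ a : M, x 0 = Sum.inl a
    | SideRel.right => fun x => ∃ b : N, x 0 = Sum.inr b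

/-- `Th(M ⊕ N)`: the complete theory of the disjoint union, in the dictionary `L ∪ {L, R}`
(Mathlib's `Language.sumStructure` combines the two interpretations above). -/
def theoryOfSum (L : FirstOrder.Language.{u, v}) [L.IsRelational] (M : Type w) (N : Type w')
    [L.Structure M] [L.Structure N] : (L.sum sideLanguage).Theory :=
  (L.sum sideLanguage).completeTheory (M ⊕ N)

end Sum

section StronglyDependent

variable {L : FirstOrder.Language.{u, v}}

/-- The set `Γ` of formulas in the free variables `α` is consistent with `T`: some model of `T`
realizes all of `Γ` under a single assignment of the variables. -/
def ConsistentWith (T : L.Theory) {α : Type w} (Γ : Set (L.Formula α)) : Prop :=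
  ∃ (N : FirstOrder.Language.Theory.ModelType.{u, v, max u v w} T) (a : α → N), ∀ ψ ∈ Γ, ψ.Realize a

/-- The variables of `Γ_φ`: a tuple `x_η` of length `m` for each `η : ι → ω`, and a tuple `y_i^j`
of length `n i` for all `i` in `ι` and `j < ω`. -/
abbrev IctVar (ι : Type w) (m : ℕ) (n : ι → ℕ) : Type w :=
  ((ι → ℕ) × Fin m) ⊕ (Σ i : ι, ℕ × Fin (n i))

/-- The formula `φ_i(x_η, y_i^j)`. -/
def ictInstance {ι : Type w} {m : ℕ} {n : ι → ℕ} (φ : ∀ i, L.Formula (Fin m ⊕ Fin (n i)))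
    (η : ι → ℕ) (i : ι) (j : ℕ) : L.Formula (IctVar ι m n) :=
  (φ i).relabel (Sum.map (fun k => (η, k)) (fun k => ⟨i, (j, k)⟩))

/-- The set `Γ_φ` of all the formulas `φ_i(x_η, y_i^j)` with `η(i) = j` and
`¬ φ_i(x_η, y_i^j)` with `η(i) ≠ j`. -/
def ictSet {ι : Type w} {m : ℕ} {n : ι → ℕ} (φ : ∀ i, L.Formula (Fin m ⊕ Fin (n i))) :
    Set (L.Formula (IctVar ι m n)) :=
  {ψ | ∃ (η : ι → ℕ) (i : ι) (j : ℕ),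
    ψ = if η i = j then ictInstance φ η i j else (ictInstance φ η i j).not}

/-- `κ^ict(T) > κ`: for some finite tuple `x` and formulas `φ_i(x, y_i)`, `i < κ`, the set `Γ_φ`
is consistent with `T`. -/
def KappaIctGT (T : L.Theory) (κ : Cardinal.{w}) : Prop :=
  ∃ (m : ℕ) (n : κ.out → ℕ) (φ : ∀ i : κ.out, L.Formula (Fin m ⊕ Fin (n i))),
    ConsistentWith T (ictSet φ)

/-- `κ^ict(T) = κ`. -/
def KappaIctEq (T : L.Theory) (κ : Cardinal.{w}) : Prop :=
  (∀ μ : Cardinal.{w}, μ < κ → KappaIctGT T μ) ∧ ¬ KappaIctGT T κ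

/-- `T` is strongly dependent¹: `κ^ict(T) = ℵ₀`. -/
def StronglyDependentOne (T : L.Theory) : Prop :=
  KappaIctEq T Cardinal.aleph0.{0}

end StronglyDependent

/-! ### Ramsey combinatorics of finite patterns -/

section Combinatorics

open Set

/-! By Feferman–Vaught, each formula over a sum is determined by the sides of its variables and
finitely many definable properties of the two parts of the tuple (`exists_alike_realize_iff`).
Suppose formulas `φ i` form a pattern with infinitely many rows in the sum. A Boolean combination
can carry a pattern that none of its constituents carries, so the constituents cannot simply replace
`φ i`. What survives is a jump: if `φ i` is true at one parameter of a row and false at an earlier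
one, some constituent differs between them. For pairs of parameters, the relation "this constituent
changes" then forms a pattern (`exists_hasPattern_differ`, `HasFinitePatterns.exists_differ`).
Finite patterns inside the structure and a Ramsey argument stand in for indiscernible sequences.

Changes of a side predicate cannot form a row, so each row comes from a definable set of one
summand. Infinitely many rows belong to the same summand, whose theory then has a pattern with `ℵ₀`
rows (`kappaIctGT_of_definable`), a contradiction. The lower bound on `κ^ict` only needs the sum to
be infinite. -/

theorem Ultrafilter.eventually_iff_of_iff {α : Type*} (U : Ultrafilter α) {p : α → Prop} {c : Prop}
    (h : (∀ᶠ x in U, p x) ↔ c) : ∀ᶠ x in U, (p x ↔ c) := by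
  by_cases hc : c
  · simpa [hc] using h
  · rw [iff_false_right hc, ← Ultrafilter.eventually_not] at h
    simpa [hc] using h

/-- A finite Ramsey theorem for finitely many `2`-colourings that may vary with `N`. -/
theorem exists_homogeneous {T : Type*} [Finite T] (P : T → ℕ → Finset ℕ → Prop) (R Q : ℕ) :
    ∃ (N : ℕ) (H : Finset ℕ), H.card = Q ∧ (∀ h ∈ H, h < N) ∧
      ∀ (t : T) (s s' : Finset ℕ), s ⊆ H → s' ⊆ H → s.card = R → s'.card = R →
        (P t N s ↔ P t N s') := by
  classical
  let U : Ultrafilter ℕ := Filter.hyperfilter ℕ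
  have hU : ∀ k : ℕ, ∀ᶠ n in U, k < n := fun k =>
    (Nat.hyperfilter_le_atTop) (Filter.eventually_gt_atTop k)
  -- `D k t s` is the limit colour of `s` after `k` further elements are adjoined along `U`; `D R t
  -- ∅` is the colour intended for every `R`-subset of `H`.
  let D : ℕ → T → Finset ℕ → Prop := fun k => Nat.rec
    (fun t s => ∀ᶠ N in U, P t N s) (fun _ D t s => ∀ᶠ n in U, D t (insert n s)) k
  have key : ∀ Q : ℕ, ∃ H : Finset ℕ, H.card = Q ∧
      ∀ s ⊆ H, ∀ t k, s.card + k = R → (D k t s ↔ D R t ∅) := by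
    intro Q
    induction Q with
    | zero =>
      refine ⟨∅, rfl, fun s hs t k hk => ?_⟩
      obtain rfl := Finset.subset_empty.1 hs
      simp only [Finset.card_empty, zero_add] at hk
      rw [hk]
    | succ Q ih =>
      obtain ⟨H, hH, hD⟩ := ih
      have h1 : ∀ᶠ n in U, ∀ s ∈ H.powerset, ∀ t, ∀ k ∈ Finset.range R, s.card + (k + 1) = R →
          (D k t (insert n s) ↔ D R t ∅) := by
        rw [Filter.eventually_all_finset]
        intro s hs
        rw [Filter.eventually_all]
        intro t
        rw [Filter.eventually_all_finset]
        intro k _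
        by_cases hk : s.card + (k + 1) = R
        · simpa [hk] using U.eventually_iff_of_iff (hD s (Finset.mem_powerset.1 hs) t (k + 1) hk)
        · simp [hk]
      have h2 : ∀ᶠ n in U, ∀ h ∈ H, h < n := by
        rw [Filter.eventually_all_finset]
        exact fun h _ => hU h
      obtain ⟨n, hn1, hn2⟩ := (h1.and h2).exists
      have hnH : n ∉ H := fun h => lt_irrefl _ (hn2 n h)
      refine ⟨insert n H, by rw [Finset.card_insert_of_notMem hnH, hH], fun s hs t k hk => ?_⟩
      by_cases hns : n ∈ s
      · have hsub : s.erase n ⊆ H := by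
          rw [← Finset.subset_insert_iff]; exact hs
        have hc := Finset.card_erase_add_one hns
        have := hn1 (s.erase n) (Finset.mem_powerset.2 hsub) t k
          (Finset.mem_range.2 (by omega)) (by omega)
        rwa [Finset.insert_erase hns] at this
      · exact hD s ((Finset.subset_insert_iff_of_notMem hns).1 hs) t k hk
  obtain ⟨H, hH, hD⟩ := key Q
  have h1 : ∀ᶠ N in U, ∀ s ∈ H.powerset, ∀ t, s.card = R → (P t N s ↔ D R t ∅) := by
    rw [Filter.eventually_all_finset]
    intro s hs
    rw [Filter.eventually_all]
    intro t
    by_cases hk : s.card = R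
    · simpa [hk] using U.eventually_iff_of_iff (hD s (Finset.mem_powerset.1 hs) t 0 hk)
    · simp [hk]
  have h2 : ∀ᶠ n in U, ∀ h ∈ H, h < n := by
    rw [Filter.eventually_all_finset]
    exact fun h _ => hU h
  obtain ⟨N, hN1, hN2⟩ := (h1.and h2).exists
  exact ⟨N, H, hH, hN2, fun t s s' hs hs' hc hc' =>
    (hN1 s (Finset.mem_powerset.2 hs) t hc).trans (hN1 s' (Finset.mem_powerset.2 hs') t hc').symm⟩

theorem Finset.exists_strictMonoOn_mem (S : Finset ℕ) :
    ∃ u : ℕ → ℕ, StrictMonoOn u (Set.Iio S.card) ∧ ∀ k < S.card, u k ∈ S := by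
  refine ⟨fun k => if h : k < S.card then S.orderEmbOfFin rfl ⟨k, h⟩ else 0, ?_, ?_⟩
  · intro k hk l hl hkl
    simp only [Set.mem_Iio] at hk hl
    simp only [hk, hl, dif_pos]
    exact (S.orderEmbOfFin rfl).strictMono hkl
  · intro k hk
    simp only [hk, dif_pos]
    exact S.orderEmbOfFin_mem rfl _

theorem exists_strictMonoOn_monochromatic (K : Type*) [Finite K] (r : ℕ) :
    ∃ W : ℕ, ∀ (col : ℕ → K) (S : Finset ℕ), W ≤ S.card → ∃ u : ℕ → ℕ,
      StrictMonoOn u (Iio r) ∧ (∀ k < r, u k ∈ S) ∧ ∀ k < r, ∀ l < r, col (u k) = col (u l) := by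
  classical
  have := Fintype.ofFinite K
  refine ⟨Fintype.card K * r + 1, fun col S hS => ?_⟩
  have hne : (Finset.univ : Finset K).Nonempty := by
    have : S.Nonempty := Finset.card_pos.1 (by omega)
    obtain ⟨x, -⟩ := this
    exact ⟨col x, Finset.mem_univ _⟩
  obtain ⟨y, -, hy⟩ := Finset.exists_le_card_fiber_of_mul_le_card_of_maps_to
    (s := S) (t := Finset.univ) (f := col) (n := r) (fun _ _ => Finset.mem_univ _) hne
    (by rw [Finset.card_univ]; omega)
  obtain ⟨u, hu1, hu2⟩ := Finset.exists_strictMonoOn_mem (S.filter fun x => col x = y)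
  refine ⟨u, hu1.mono (Iio_subset_Iio hy), fun k hk => ?_, fun k hk l hl => ?_⟩
  · exact (Finset.mem_filter.1 (hu2 k (by omega))).1
  · rw [(Finset.mem_filter.1 (hu2 k (by omega))).2, (Finset.mem_filter.1 (hu2 l (by omega))).2]

theorem StrictMonoOn.eqOn_Iio_of_image_eq {f g : ℕ → ℕ} {R : ℕ} (hf : StrictMonoOn f (Iio R))
    (hg : StrictMonoOn g (Iio R)) (h : (Finset.range R).image f = (Finset.range R).image g) :
    ∀ k < R, f k = g k := by
  have hf' : StrictMono fun k : Fin R => f k := fun a b hab => hf a.2 b.2 hab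
  have hg' : StrictMono fun k : Fin R => g k := fun a b hab => hg a.2 b.2 hab
  have hr : Set.range (fun k : Fin R => f k) = Set.range (fun k : Fin R => g k) := by
    ext x
    have := congrArg (x ∈ ·) h
    simp only [Finset.mem_image, Finset.mem_range, eq_iff_iff] at this
    simpa [Fin.exists_iff] using this
  intro k hk
  exact congrFun ((StrictMono.range_inj hf' hg').1 hr) ⟨k, hk⟩

/-- Relations `R i`, `i < n`, contain a pattern with rows `b i 0, …, b i (q - 1)` in which every
path through the rows is realized by an element. -/
def HasPattern {X : Type*} {Y : ℕ → Type*} (R : ∀ i, X → Y i → Prop) (n q : ℕ) : Prop :=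
  ∃ b : ∀ i, ℕ → Y i, ∀ η : ℕ → ℕ, (∀ i < n, η i < q) →
    ∃ a : X, ∀ i < n, ∀ j < q, (R i a (b i j) ↔ η i = j)

theorem HasPattern.mono {X : Type*} {Y : ℕ → Type*} {R : ∀ i, X → Y i → Prop} {n n' q q' : ℕ}
    (h : HasPattern R n' q') (hn : n ≤ n') (hq : q ≤ q') (h0 : 0 < q') : HasPattern R n q := by
  obtain ⟨b, hb⟩ := h
  refine ⟨b, fun η hη => ?_⟩
  obtain ⟨a, ha⟩ := hb (fun i => if i < n then η i else 0) (fun i hi => by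
    show (if i < n then η i else 0) < q'
    split_ifs with h
    · exact (hη i h).trans_le hq
    · exact h0)
  refine ⟨a, fun i hi j hj => ?_⟩
  have := ha i (by omega) j (by omega)
  simpa [hi] using this


/-- `HasPattern R n q` for all `n` and `q`. -/
def HasFinitePatterns {X : Type*} {Y : ℕ → Type*} (R : ∀ i, X → Y i → Prop) : Prop :=
  ∀ n q, HasPattern R n q

/-- The relation that holds when `P x y` and `P x y'` differ. -/
def differ {X Y : Type*} (P : X → Y → Prop) (x : X) (y : Y × Y) : Prop :=
  ¬ (P x y.1 ↔ P x y.2)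

/-- A single element `a`, whose `R`-path runs through the centres `c i` of disjoint blocks of
columns, realizes all paths of changes: only the selection of columns around the centres varies with
`η`. Homogeneity then moves these selections to one common selection, at the cost of replacing `a`.
-/
theorem exists_hasPattern_differ {X : Type*} {Y O : ℕ → Type*} [∀ i, Finite (O i)]
    (P : ∀ i, O i → X → Y i → Prop) (R : ∀ i, X → Y i → Prop)
    (hR : ∀ i x x' y y', (∀ o, P i o x y ↔ P i o x' y') → (R i x y ↔ R i x' y'))
    (h : HasFinitePatterns R) (n q : ℕ) (hq : 0 < q) :
    ∃ o : ∀ i : Fin n, O i, ∃ b : ∀ i : Fin n, ℕ → Y i × Y i, ∀ η : Fin n → Fin q, ∃ a : X,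
      ∀ i : Fin n, ∀ j < q, (differ (P i (o i)) a (b i j) ↔ η i = j) := by
  classical
  obtain ⟨W, hW⟩ := exists_strictMonoOn_monochromatic (∀ i : Fin n, O i → Prop) (2 * q)
  choose b hb using fun N => h n N
  let pairs : ∀ (N : ℕ) (f : ℕ → ℕ) (i : ℕ) (j : ℕ), Y i × Y i := fun N f i j =>
    (b N i (f (i * (2 * q) + 2 * j)), b N i (f (i * (2 * q) + (2 * j + 1))))
  -- Each row gets its own block of `2 * W + 1` columns in `H`, with `W` on either side of a centre.
  -- The colourings depend on `N` because the pattern `b N` does.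
  obtain ⟨N, H, hHc, hHN, hH⟩ := exists_homogeneous
    (T := (∀ i : Fin n, O i) × (Fin n → Fin q))
    (fun t N s => ∃ f : ℕ → ℕ, StrictMonoOn f (Iio (n * (2 * q))) ∧
      s = (Finset.range (n * (2 * q))).image f ∧ ∃ a : X, ∀ i : Fin n, ∀ j < q,
        (differ (P i (t.1 i)) a (pairs N f i j) ↔ t.2 i = j))
    (n * (2 * q)) (n * (2 * W + 1))
  obtain ⟨g, hg, hgH⟩ := H.exists_strictMonoOn_mem
  rw [hHc] at hg hgH
  have hlt : ∀ i < n, ∀ p < 2 * W + 1, i * (2 * W + 1) + p < n * (2 * W + 1) := by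
    intro i hi p hp
    calc i * (2 * W + 1) + p < (i + 1) * (2 * W + 1) := by linarith
      _ ≤ n * (2 * W + 1) := Nat.mul_le_mul_right _ hi
  let c : ℕ → ℕ := fun i => g (i * (2 * W + 1) + W)
  obtain ⟨a, ha⟩ := hb N c fun i hi => hHN _ (hgH _ (hlt i hi W (by omega)))
  let col : ℕ → ∀ i : Fin n, O i → Prop := fun j i o => P i o a (b N i j)
  have hlow : ∀ i < n, ∃ u : ℕ → ℕ, StrictMonoOn u (Iio (2 * q)) ∧
      (∀ k < 2 * q, ∃ p < W, u k = g (i * (2 * W + 1) + p)) ∧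
      ∀ k < 2 * q, ∀ l < 2 * q, col (u k) = col (u l) := by
    intro i hi
    obtain ⟨u, hu1, hu2, hu3⟩ := hW col
      ((Finset.range W).image fun p => g (i * (2 * W + 1) + p)) (by
        rw [Finset.card_image_of_injOn, Finset.card_range]
        intro p hp p' hp' hpp
        simp only [Finset.coe_range, mem_Iio] at hp hp'
        have := hg.injOn (hlt i hi p (by omega)) (hlt i hi p' (by omega)) hpp
        omega)
    refine ⟨u, hu1, fun k hk => ?_, hu3⟩
    obtain ⟨p, hp, hpu⟩ := Finset.mem_image.1 (hu2 k hk)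
    exact ⟨p, Finset.mem_range.1 hp, hpu.symm⟩
  have hhigh : ∀ i < n, ∃ u : ℕ → ℕ, StrictMonoOn u (Iio (2 * q)) ∧
      (∀ k < 2 * q, ∃ p < W, u k = g (i * (2 * W + 1) + (W + 1 + p))) ∧
      ∀ k < 2 * q, ∀ l < 2 * q, col (u k) = col (u l) := by
    intro i hi
    obtain ⟨u, hu1, hu2, hu3⟩ := hW col
      ((Finset.range W).image fun p => g (i * (2 * W + 1) + (W + 1 + p))) (by
        rw [Finset.card_image_of_injOn, Finset.card_range]
        intro p hp p' hp' hpp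
        simp only [Finset.coe_range, mem_Iio] at hp hp'
        have := hg.injOn (hlt i hi (W + 1 + p) (by omega)) (hlt i hi (W + 1 + p') (by omega)) hpp
        omega)
    refine ⟨u, hu1, fun k hk => ?_, hu3⟩
    obtain ⟨p, hp, hpu⟩ := Finset.mem_image.1 (hu2 k hk)
    exact ⟨p, Finset.mem_range.1 hp, hpu.symm⟩
  choose! u hu hup huc using hlow
  choose! v hv hvp hvc using hhigh
  -- `R i` holds at the centre and fails at `u i 0`, so some `P i o` tells them apart.
  have hjump : ∀ i : Fin n, ∃ o : O i, ¬ (P i o a (b N i (u i 0)) ↔ P i o a (b N i (c i))) := by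
    intro i
    by_contra hcon
    push Not at hcon
    have h1 := hR i a a (b N i (u i 0)) (b N i (c i)) hcon
    obtain ⟨p, hp, hpu⟩ := hup i i.2 0 (by omega)
    have hmem := hlt i i.2 p (by omega)
    rw [ha i i.2 (u i 0) (by rw [hpu]; exact hHN _ (hgH _ hmem)),
      ha i i.2 (c i) (hHN _ (hgH _ (hlt i i.2 W (by omega))))] at h1
    have h2 : c i = u i 0 := h1.2 rfl
    rw [hpu] at h2
    have := hg.injOn (hlt i i.2 W (by omega)) hmem h2
    omega
  choose o ho using hjump
  -- The centre sits at the odd position `2 * η i + 1`, so the pair `(2 * j, 2 * j + 1)` contains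
  -- the jump from `u` to `c` exactly when `j = η i`. The passage from `c` to `v` falls between two
  -- pairs and is not seen.
  let e : (Fin n → Fin q) → ℕ → ℕ → ℕ := fun η i k => if hi : i < n then
    if k < 2 * (η ⟨i, hi⟩ : ℕ) + 1 then u i k else
      if k = 2 * (η ⟨i, hi⟩ : ℕ) + 1 then c i else v i k else 0
  have hepos : ∀ η, ∀ i < n, ∀ k < 2 * q, ∃ p < 2 * W + 1, e η i k = g (i * (2 * W + 1) + p) := by
    intro η i hi k hk
    simp only [e, hi, dif_pos]
    split_ifs
    · obtain ⟨p, hp, hpe⟩ := hup i hi k hk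
      exact ⟨p, by omega, hpe⟩
    · exact ⟨W, by omega, rfl⟩
    · obtain ⟨p, hp, hpe⟩ := hvp i hi k hk
      exact ⟨W + 1 + p, by omega, hpe⟩
  have hemono : ∀ η, ∀ i < n, ∀ k < 2 * q, ∀ l < 2 * q, k < l → e η i k < e η i l := by
    intro η i hi k hk l hl hkl
    simp only [e, hi, dif_pos]
    have hlow : ∀ k < 2 * q, u i k < c i := by
      intro k hk
      obtain ⟨p, hp, hpe⟩ := hup i hi k hk
      rw [hpe]
      exact hg (hlt i hi p (by omega)) (hlt i hi W (by omega)) (by omega)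
    have hhigh : ∀ k < 2 * q, c i < v i k := by
      intro k hk
      obtain ⟨p, hp, hpe⟩ := hvp i hi k hk
      rw [hpe]
      exact hg (hlt i hi W (by omega)) (hlt i hi (W + 1 + p) (by omega)) (by omega)
    split_ifs
    · exact hu i hi hk hl hkl
    · exact hlow k hk
    · exact (hlow k hk).trans (hhigh l hl)
    · omega
    · omega
    · exact hhigh l hl
    · omega
    · omega
    · exact hv i hi hk hl hkl
  let f : (Fin n → Fin q) → ℕ → ℕ := fun η p => e η (p / (2 * q)) (p % (2 * q))
  have hdiv : ∀ p < n * (2 * q), p / (2 * q) < n := fun p hp =>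
    Nat.div_lt_of_lt_mul (by rwa [mul_comm])
  have hmod : ∀ p, p % (2 * q) < 2 * q := fun p => Nat.mod_lt _ (by omega)
  have hf : ∀ η, StrictMonoOn (f η) (Iio (n * (2 * q))) := by
    intro η p hp p' hp' hpp
    rcases (Nat.div_le_div_right (c := 2 * q) hpp.le).lt_or_eq with hlt' | heq
    · obtain ⟨r, hr, hre⟩ := hepos η _ (hdiv p hp) _ (hmod p)
      obtain ⟨r', hr', hre'⟩ := hepos η _ (hdiv p' hp') _ (hmod p')
      simp only [f]
      rw [hre, hre']
      refine hg (hlt _ (hdiv p hp) _ hr) (hlt _ (hdiv p' hp') _ hr') ?_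
      calc p / (2 * q) * (2 * W + 1) + r < (p / (2 * q) + 1) * (2 * W + 1) := by linarith
        _ ≤ p' / (2 * q) * (2 * W + 1) := Nat.mul_le_mul_right _ hlt'
        _ ≤ _ := Nat.le_add_right _ _
    · simp only [f]
      rw [← heq]
      refine hemono η _ (hdiv p hp) _ (hmod p) _ (hmod p') ?_
      have h1 := Nat.div_add_mod p (2 * q)
      have h2 := Nat.div_add_mod p' (2 * q)
      rw [← heq] at h2
      omega
  have hfH : ∀ η, (Finset.range (n * (2 * q))).image (f η) ⊆ H := by
    intro η x hx
    obtain ⟨p, hp, rfl⟩ := Finset.mem_image.1 hx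
    rw [Finset.mem_range] at hp
    obtain ⟨r, hr, hre⟩ := hepos η _ (hdiv p hp) _ (hmod p)
    simp only [f, hre]
    exact hgH _ (hlt _ (hdiv p hp) _ hr)
  have hfc : ∀ η, ((Finset.range (n * (2 * q))).image (f η)).card = n * (2 * q) := by
    intro η
    rw [Finset.card_image_of_injOn, Finset.card_range]
    rw [Finset.coe_range]
    exact (hf η).injOn
  have hfe : ∀ η, ∀ i < n, ∀ k < 2 * q, f η (i * (2 * q) + k) = e η i k := by
    intro η i hi k hk
    simp only [f]
    rw [Nat.add_comm, Nat.add_mul_div_right _ _ (by omega), Nat.add_mul_mod_self_right,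
      Nat.div_eq_of_lt hk, Nat.mod_eq_of_lt hk, zero_add]
  have hfa : ∀ η : Fin n → Fin q, ∀ i : Fin n, ∀ j < q,
      (differ (P i (o i)) a (pairs N (f η) i j) ↔ η i = j) := by
    intro η i j hj
    have hcu : ∀ k < 2 * q, ∀ l < 2 * q,
        (P i (o i) a (b N i (u i k)) ↔ P i (o i) a (b N i (u i l))) := fun k hk l hl =>
      iff_of_eq (congrFun (congrFun (huc i i.2 k hk l hl) i) (o i))
    have hcv : ∀ k < 2 * q, ∀ l < 2 * q,
        (P i (o i) a (b N i (v i k)) ↔ P i (o i) a (b N i (v i l))) := fun k hk l hl =>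
      iff_of_eq (congrFun (congrFun (hvc i i.2 k hk l hl) i) (o i))
    simp only [pairs, differ, hfe η i i.2 (2 * j) (by omega), hfe η i i.2 (2 * j + 1) (by omega),
      e, i.2, dif_pos, Fin.eta]
    rcases lt_trichotomy j (η i) with hlt | heq | hgt
    · rw [if_pos (by omega), if_pos (by omega)]
      have := hcu (2 * j) (by omega) (2 * j + 1) (by omega)
      simp only [this, not_true_eq_false, false_iff]
      omega
    · subst heq
      rw [if_pos (by omega), if_neg (by omega), if_pos rfl, hcu _ (by omega) 0 (by omega)]
      simpa using ho i
    · rw [if_neg (by omega), if_neg (by omega), if_neg (by omega), if_neg (by omega)]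
      have := hcv (2 * j) (by omega) (2 * j + 1) (by omega)
      simp only [this, not_true_eq_false, false_iff]
      omega
  let η₀ : Fin n → Fin q := fun _ => ⟨0, hq⟩
  refine ⟨o, fun i j => pairs N (f η₀) i j, fun η => ?_⟩
  -- The columns selected for `η` are traded for those of `η₀`; the increasing enumeration of a
  -- finite set is unique, so `f'` agrees with `f η₀`.
  obtain ⟨f', hf', hfim, a', ha'⟩ := (hH (o, η) _ _ (hfH η) (hfH η₀) (hfc η) (hfc η₀)).1
    ⟨f η, hf η, rfl, a, hfa η⟩
  refine ⟨a', fun i j hj => ?_⟩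
  have heq := (hf η₀).eqOn_Iio_of_image_eq hf' hfim
  have hb1 : ∀ k < 2 * q, (i : ℕ) * (2 * q) + k < n * (2 * q) := by
    intro k hk
    calc (i : ℕ) * (2 * q) + k < ((i : ℕ) + 1) * (2 * q) := by linarith
      _ ≤ n * (2 * q) := Nat.mul_le_mul_right _ i.2
  have := ha' i j hj
  simp only [pairs] at this ⊢
  rwa [heq _ (hb1 _ (by omega)), heq _ (hb1 _ (by omega))]

/-- If each `R i` is determined by finitely many relations `P i o`, then finite patterns for `R`
give, for a suitable choice of `o i`, finite patterns for the relations "`P i (o i)` changes". -/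
theorem HasFinitePatterns.exists_differ {X : Type*} {Y O : ℕ → Type*} [∀ i, Finite (O i)]
    [∀ i, Nonempty (O i)] [∀ i, Nonempty (Y i)]
    (P : ∀ i, O i → X → Y i → Prop) (R : ∀ i, X → Y i → Prop)
    (hR : ∀ i x x' y y', (∀ o, P i o x y ↔ P i o x' y') → (R i x y ↔ R i x' y'))
    (h : HasFinitePatterns R) :
    ∃ o : ∀ i, O i, HasFinitePatterns fun i => differ (P i (o i)) := by
  classical
  have key : ∀ n, ∃ o : ∀ i, O i, HasPattern (fun i => differ (P i (o i))) n (n + 1) := by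
    intro n
    obtain ⟨o, b, hb⟩ := exists_hasPattern_differ P R hR h n (n + 1) (Nat.succ_pos n)
    refine ⟨fun i => if hi : i < n then o ⟨i, hi⟩ else Classical.arbitrary _,
      fun i => if hi : i < n then b ⟨i, hi⟩ else Classical.arbitrary _, fun η hη => ?_⟩
    obtain ⟨a, ha⟩ := hb fun i => ⟨η i, hη i i.2⟩
    refine ⟨a, fun i hi j hj => ?_⟩
    have := ha ⟨i, hi⟩ j hj
    simpa only [hi, dif_pos] using this
  choose o ho using key
  -- The choices `o n` vary with the size of the pattern. As each `O i` is finite, they have a limit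
  -- along `U`, attained on any finite set of rows by some large `N`.
  let U : Ultrafilter ℕ := Filter.hyperfilter ℕ
  have hlim : ∀ i, ∃ x : O i, ∀ᶠ n in U, o n i = x := by
    intro i
    exact (Ultrafilter.eventually_exists_iff (f := U) (P := fun x n => o n i = x)).1 (by simp)
  choose x hx using hlim
  refine ⟨x, fun n q => ?_⟩
  have h1 : ∀ᶠ N in U, ∀ i ∈ Finset.range n, o N i = x i := by
    rw [Filter.eventually_all_finset]
    exact fun i _ => hx i
  have h2 : ∀ᶠ N in U, max n q < N := Nat.hyperfilter_le_atTop (Filter.eventually_gt_atTop _)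
  obtain ⟨N, hN1, hN2⟩ := (h1.and h2).exists
  obtain ⟨b, hb⟩ := (ho N).mono (n := n) (q := q) (by omega) (by omega) (by omega)
  refine ⟨b, fun η hη => ?_⟩
  obtain ⟨a, ha⟩ := hb η hη
  refine ⟨a, fun i hi j hj => ?_⟩
  beta_reduce
  rw [← hN1 i (Finset.mem_range.2 hi)]
  exact ha i hi j hj

theorem HasFinitePatterns.comp_injective {X : Type*} {Y : ℕ → Type*} {R : ∀ i, X → Y i → Prop}
    (h : HasFinitePatterns R) {g : ℕ → ℕ} (hg : g.Injective) :
    HasFinitePatterns fun i => R (g i) := by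
  intro n q
  obtain ⟨N, hN⟩ : ∃ N, ∀ i < n, g i < N := by
    obtain ⟨N, hN⟩ := ((Finset.range n).image g).bddAbove
    refine ⟨N + 1, fun i hi => Nat.lt_succ_of_le (hN ?_)⟩
    simpa using ⟨i, hi, rfl⟩
  -- Rows outside the image of `g` take the column `0`, which needs `0 < q`.
  rcases Nat.eq_zero_or_pos q with rfl | hq
  · obtain ⟨b, hb⟩ := h N 1
    obtain ⟨a, -⟩ := hb 0 (by simp)
    exact ⟨fun i => b (g i), fun η hη => ⟨a, fun i _ j hj => absurd hj (by omega)⟩⟩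
  classical
  obtain ⟨b, hb⟩ := h N q
  refine ⟨fun i => b (g i), fun η hη => ?_⟩
  obtain ⟨a, ha⟩ := hb (fun k => if hk : ∃ i < n, g i = k then η hk.choose else 0) (by
    intro k _
    split_ifs with hk
    · exact hη _ hk.choose_spec.1
    · exact hq)
  refine ⟨a, fun i hi j hj => ?_⟩
  have hk : ∃ i' < n, g i' = g i := ⟨i, hi, rfl⟩
  have := ha (g i) (hN i hi) j hj
  rwa [dif_pos hk, hg hk.choose_spec.2] at this

end Combinatorics

/-! ### Compactness: infinite patterns versus finite patterns in one structure -/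

section Compactness

open FirstOrder FirstOrder.Language

variable {L : FirstOrder.Language.{u, v}}

theorem consistentWith_completeTheory {M : Type w'} [L.Structure M] [Nonempty M] {α : Type w}
    {Γ : Set (L.Formula α)}
    (h : ∀ Γ₀ ⊆ Γ, Γ₀.Finite → ∃ a : α → M, ∀ ψ ∈ Γ₀, ψ.Realize a) :
    ConsistentWith (L.completeTheory M) Γ := by
  let T' : L[[α]].Theory :=
    (L.lhomWithConstants α).onTheory (L.completeTheory M) ∪ Formula.equivSentence '' Γ
  have hT' : T'.IsSatisfiable := by
    rw [Theory.isSatisfiable_iff_isFinitelySatisfiable]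
    intro T₀ hT₀
    obtain ⟨a, ha⟩ := h {ψ | ψ ∈ Γ ∧ Formula.equivSentence ψ ∈ T₀} (fun ψ hψ => hψ.1)
      ((T₀.finite_toSet.preimage Formula.equivSentence.injective.injOn).subset fun ψ hψ => hψ.2)
    let _ : (constantsOn α).Structure M := constantsOn.structure a
    have h1 : M ⊨ (L.lhomWithConstants α).onTheory (L.completeTheory M) :=
      (LHom.onTheory_model _ _).2 inferInstance
    have : M ⊨ (T₀ : L[[α]].Theory) := by
      refine ⟨fun χ hχ => ?_⟩
      rcases hT₀ hχ with h2 | ⟨ψ, hψ, rfl⟩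
      · exact h1.realize_of_mem χ h2
      · exact (Formula.realize_equivSentence M ψ).2 (ha ψ ⟨hψ, hχ⟩)
    exact Theory.Model.isSatisfiable M
  obtain ⟨N⟩ := hT'
  have h1 : N ⊨ (L.lhomWithConstants α).onTheory (L.completeTheory M) :=
    N.is_model.mono Set.subset_union_left
  let _ : L.Structure N := (L.lhomWithConstants α).reduct N
  have h2 : N ⊨ L.completeTheory M := (LHom.onTheory_model (L.lhomWithConstants α) _).1 h1
  refine ⟨Theory.ModelType.of _ N, fun x => (L.con x : N), fun ψ hψ => ?_⟩
  exact (Formula.realize_equivSentence N ψ).1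
    (N.is_model.realize_of_mem _ (Or.inr ⟨ψ, hψ, rfl⟩))

theorem exists_realize_of_model_completeTheory {M : Type w} {N : Type w'} [L.Structure M]
    [L.Structure N] [N ⊨ L.completeTheory M] {γ ι : Type*} [Finite γ] [Finite ι]
    (ψ : ι → L.Formula γ) (v : γ → N) (hv : ∀ t, (ψ t).Realize v) :
    ∃ v : γ → M, ∀ t, (ψ t).Realize v := by
  let χ : L.Sentence := ((Formula.iInf ψ).relabel (Sum.inr : γ → Empty ⊕ γ)).iExs γ
  have h1 : N ⊨ χ := by
    refine Formula.realize_iExs.2 ⟨v, ?_⟩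
    rw [Formula.realize_relabel, Sum.elim_comp_inr, Formula.realize_iInf]
    exact hv
  obtain ⟨v', hv'⟩ := Formula.realize_iExs.1 ((realize_iff_of_model_completeTheory M N χ).1 h1)
  rw [Formula.realize_relabel, Sum.elim_comp_inr, Formula.realize_iInf] at hv'
  exact ⟨v', hv'⟩

theorem realize_relabel_sumMap {M : Type w} [L.Structure M] {α β α' β' : Type*}
    (φ : L.Formula (α ⊕ β)) (f : α → α') (g : β → β') (v : α' ⊕ β' → M) :
    (φ.relabel (Sum.map f g)).Realize v ↔
      φ.Realize (Sum.elim (fun k => v (Sum.inl (f k))) fun k => v (Sum.inr (g k))) := by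
  rw [Formula.realize_relabel]
  refine iff_of_eq (congrArg _ (funext fun k => ?_))
  cases k <;> rfl

theorem realize_ictInstance {M : Type w'} [L.Structure M] {ι : Type w} {m : ℕ} {n : ι → ℕ}
    (φ : ∀ i, L.Formula (Fin m ⊕ Fin (n i))) (η : ι → ℕ) (i : ι) (j : ℕ) (a : IctVar ι m n → M) :
    (ictInstance φ η i j).Realize a ↔ (φ i).Realize
      (Sum.elim (fun k => a (Sum.inl (η, k))) fun k => a (Sum.inr ⟨i, (j, k)⟩)) :=
  realize_relabel_sumMap ..

theorem realize_ictSet_iff {M : Type w'} [L.Structure M] {ι : Type w} {m : ℕ} {n : ι → ℕ}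
    (φ : ∀ i, L.Formula (Fin m ⊕ Fin (n i))) (a : IctVar ι m n → M) :
    (∀ ψ ∈ ictSet φ, ψ.Realize a) ↔ ∀ η i j, (φ i).Realize
      (Sum.elim (fun k => a (Sum.inl (η, k))) fun k => a (Sum.inr ⟨i, (j, k)⟩)) ↔ η i = j := by
  constructor
  · intro h η i j
    rw [← realize_ictInstance]
    have := h _ ⟨η, i, j, rfl⟩
    split_ifs at this with hij
    · exact iff_of_true this hij
    · exact iff_of_false (Formula.realize_not.1 this) hij
  · rintro h ψ ⟨η, i, j, rfl⟩
    split_ifs with hij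
    · exact (realize_ictInstance ..).2 ((h η i j).2 hij)
    · exact Formula.realize_not.2 fun h' => hij ((h η i j).1 ((realize_ictInstance ..).1 h'))

/-- The parameters of one row are pairwise distinct, since each path selects exactly one of them. -/
theorem infinite_of_kappaIctGT_one {M : Type w'} [L.Structure M]
    (h : KappaIctGT (L.completeTheory M) (1 : Cardinal.{w})) : Infinite M := by
  obtain ⟨m, n, φ, N, a, ha⟩ := h
  rw [realize_ictSet_iff] at ha
  have hne : Nonempty (1 : Cardinal.{w}).out := by
    rw [← Cardinal.mk_ne_zero_iff, Cardinal.mk_out]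
    exact one_ne_zero
  obtain ⟨i⟩ := hne
  have hN : Infinite N := by
    by_contra hfin
    rw [not_infinite_iff_finite] at hfin
    refine not_injective_infinite_finite
      (fun (j : ℕ) (k : Fin (n i)) => a (Sum.inr ⟨i, (j, k)⟩)) fun j j' hjj => ?_
    have h1 := (ha (fun _ => j) i j).2 rfl
    dsimp only at hjj
    rw [hjj] at h1
    exact (ha (fun _ => j) i j').1 h1
  have hMN : N ≅[L] M := (elementarilyEquivalent_iff).2 fun φ =>
    realize_iff_of_model_completeTheory M N φ
  exact hMN.infinite

/-- For finitely many rows, equalities `x_i = y` suffice: `x_η` lists the values of `η`, coded by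
distinct elements. -/
theorem kappaIctGT_of_infinite {M : Type w'} [L.Structure M] [Infinite M] {μ : Cardinal.{w}}
    (hμ : μ < Cardinal.aleph0) : KappaIctGT (L.completeTheory M) μ := by
  have : Finite μ.out := Cardinal.lt_aleph0_iff_finite.1 (by rwa [Cardinal.mk_out])
  let e := Finite.equivFin μ.out
  let f := Infinite.natEmbedding M
  refine ⟨Nat.card μ.out, fun _ => 1, fun i =>
    (Term.var (Sum.inl (e i))).equal (Term.var (Sum.inr 0)), consistentWith_completeTheory ?_⟩
  refine fun Γ₀ hΓ₀ _ => ⟨Sum.elim (fun p => f (p.1 (e.symm p.2))) fun p => f p.2.1, ?_⟩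
  refine fun ψ hψ => (realize_ictSet_iff _ _).2 (fun η i j => ?_) ψ (hΓ₀ hψ)
  simp [Formula.realize_equal]

theorem hasFinitePatterns_of_kappaIctGT {M : Type w'} [L.Structure M] [Nonempty M]
    (h : KappaIctGT (L.completeTheory M) Cardinal.aleph0.{0}) :
    ∃ (m : ℕ) (n : ℕ → ℕ) (φ : ∀ i, L.Formula (Fin m ⊕ Fin (n i))),
      HasFinitePatterns fun i (x : Fin m → M) (y : Fin (n i) → M) =>
        (φ i).Realize (Sum.elim x y) := by
  obtain ⟨m, n, φ, N, a, ha⟩ := h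
  rw [realize_ictSet_iff] at ha
  obtain ⟨e⟩ : Nonempty (Cardinal.aleph0.{0}.out ≃ ℕ) := by
    rw [← Cardinal.eq, Cardinal.mk_out, Cardinal.mk_nat]
  refine ⟨m, fun i => n (e.symm i), fun i => φ (e.symm i), fun k q => ?_⟩
  classical
  let rel : (Fin k → Fin q) → ∀ i : Fin k, Fin q → L.Formula
      (((Fin k → Fin q) × Fin m) ⊕ (Σ i : Fin k, Fin q × Fin (n (e.symm i)))) := fun η i j =>
    (φ (e.symm i)).relabel (Sum.map (fun t => (η, t)) fun t => ⟨i, (j, t)⟩)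
  let ext : (Fin k → Fin q) → Cardinal.aleph0.{0}.out → ℕ := fun η i =>
    if h : e i < k then η ⟨e i, h⟩ else 0
  have hext : ∀ η (i : Fin k), ext η (e.symm i) = η i := by
    intro η i
    simp [ext]
  obtain ⟨v, hv⟩ := exists_realize_of_model_completeTheory (M := M) (N := N)
    (ι := (Fin k → Fin q) × Fin k × Fin q)
    (fun t => if t.1 t.2.1 = t.2.2 then rel t.1 t.2.1 t.2.2 else (rel t.1 t.2.1 t.2.2).not)
    (Sum.elim (fun p => a (Sum.inl (ext p.1, p.2)))
      fun p => a (Sum.inr ⟨e.symm p.1, (p.2.1, p.2.2)⟩)) (by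
    rintro ⟨η, i, j⟩
    have := ha (ext η) (e.symm i) j
    rw [hext, Fin.val_inj] at this
    dsimp only
    split_ifs with hij
    · exact (realize_relabel_sumMap ..).2 (this.2 hij)
    · refine Formula.realize_not.2 fun h' => hij (this.1 ?_)
      simp only [rel] at h'
      rw [realize_relabel_sumMap] at h'
      exact h')
  have hv' : ∀ (η : Fin k → Fin q) (i : Fin k) (j : Fin q),
      (rel η i j).Realize v ↔ η i = j := by
    intro η i j
    have := hv (η, i, j)
    dsimp only at this
    split_ifs at this with hij
    · exact iff_of_true this hij
    · exact iff_of_false (Formula.realize_not.1 this) hij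
  refine ⟨fun i j t => if hij : i < k ∧ j < q then v (Sum.inr ⟨⟨i, hij.1⟩, (⟨j, hij.2⟩, t)⟩)
    else Classical.arbitrary M, fun η hη => ?_⟩
  let η' : Fin k → Fin q := fun i => ⟨η i, hη i i.2⟩
  refine ⟨fun t => v (Sum.inl (η', t)), fun i hi j hj => ?_⟩
  have := hv' η' ⟨i, hi⟩ ⟨j, hj⟩
  simp only [rel] at this
  rw [realize_relabel_sumMap, ← Fin.val_inj] at this
  simpa only [hi, hj, and_self, dif_pos] using this

theorem kappaIctGT_of_hasFinitePatterns {M : Type w'} [L.Structure M] [Nonempty M] {m : ℕ}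
    {n : ℕ → ℕ} {φ : ∀ i, L.Formula (Fin m ⊕ Fin (n i))}
    (h : HasFinitePatterns fun i (x : Fin m → M) (y : Fin (n i) → M) =>
      (φ i).Realize (Sum.elim x y)) :
    KappaIctGT (L.completeTheory M) Cardinal.aleph0.{0} := by
  obtain ⟨e⟩ : Nonempty (Cardinal.aleph0.{0}.out ≃ ℕ) := by
    rw [← Cardinal.eq, Cardinal.mk_out, Cardinal.mk_nat]
  refine ⟨m, fun i => n (e i), fun i => φ (e i), consistentWith_completeTheory ?_⟩
  intro Γ₀ hΓ₀ hfin
  classical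
  obtain ⟨E, hE⟩ : ∃ E : Finset ((Cardinal.aleph0.{0}.out → ℕ) × Cardinal.aleph0.{0}.out × ℕ),
      ∀ ψ ∈ Γ₀, ∃ t ∈ E, ψ = if t.1 t.2.1 = t.2.2
        then ictInstance (fun i => φ (e i)) t.1 t.2.1 t.2.2
        else (ictInstance (fun i => φ (e i)) t.1 t.2.1 t.2.2).not := by
    choose η i j hψ using fun ψ : hfin.toFinset => hΓ₀ (hfin.mem_toFinset.1 ψ.2)
    exact ⟨Finset.univ.image fun ψ => (η ψ, i ψ, j ψ), fun ψ hψΓ => ⟨_,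
      Finset.mem_image_of_mem _ (Finset.mem_univ ⟨ψ, hfin.mem_toFinset.2 hψΓ⟩),
        hψ ⟨ψ, hfin.mem_toFinset.2 hψΓ⟩⟩⟩
  obtain ⟨k, hk⟩ : ∃ k, ∀ t ∈ E, e t.2.1 < k := by
    obtain ⟨k, hk⟩ := (E.image fun t => e t.2.1).bddAbove
    exact ⟨k + 1, fun t ht => Nat.lt_succ_of_le (hk (Finset.mem_image_of_mem _ ht))⟩
  obtain ⟨q₁, hq₁⟩ : ∃ q, ∀ t ∈ E, t.2.2 < q := by
    obtain ⟨k, hk⟩ := (E.image fun t => t.2.2).bddAbove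
    exact ⟨k + 1, fun t ht => Nat.lt_succ_of_le (hk (Finset.mem_image_of_mem _ ht))⟩
  -- A finite pattern realizes only paths with values below its width, so the width must also bound
  -- the values of the paths in `E`, not just the columns mentioned.
  obtain ⟨q₂, hq₂⟩ : ∃ q, ∀ t ∈ E, ∀ i < k, t.1 (e.symm i) < q := by
    obtain ⟨q, hq⟩ := ((E ×ˢ Finset.range k).image fun p => p.1.1 (e.symm p.2)).bddAbove
    refine ⟨q + 1, fun t ht i hi => Nat.lt_succ_of_le (hq ?_)⟩
    exact Finset.mem_image.2
      ⟨(t, i), Finset.mem_product.2 ⟨ht, Finset.mem_range.2 hi⟩, rfl⟩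
  obtain ⟨b, hb⟩ := h k (max q₁ q₂)
  choose! x hx using hb
  refine ⟨Sum.elim (fun p => x (fun i => p.1 (e.symm i)) p.2) fun p => b (e p.1) p.2.1 p.2.2,
    fun ψ hψ => ?_⟩
  obtain ⟨⟨η, i, j⟩, ht, rfl⟩ := hE ψ hψ
  have h1 := hx (fun i => η (e.symm i)) (fun i hi => (hq₂ _ ht i hi).trans_le (le_max_right _ _))
    (e i) (hk _ ht) j ((hq₁ _ ht).trans_le (le_max_left _ _))
  simp only [e.symm_apply_apply] at h1
  dsimp only
  split_ifs with hij
  · exact (realize_ictInstance ..).2 (h1.2 hij)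
  · exact Formula.realize_not.2 fun h' => hij (h1.1 ((realize_ictInstance ..).1 h'))

end Compactness

/-! ### Feferman–Vaught for disjoint sums -/

section Sum

open FirstOrder FirstOrder.Language

variable {τ : FirstOrder.Language.{u, v}} [τ.IsRelational]

/-- The part of a tuple of `M ⊕ N` in `M`, where elements of `N` are replaced by `c`. -/
def leftPart {M : Type w} {N : Type w'} {α : Type*} (c : M) (z : α → M ⊕ N) : α → M :=
  fun k => Sum.elim id (fun _ => c) (z k)

/-- The part of a tuple of `M ⊕ N` in `N`, where elements of `M` are replaced by `d`. -/
def rightPart {M : Type w} {N : Type w'} {α : Type*} (d : N) (z : α → M ⊕ N) : α → N :=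
  fun k => Sum.elim (fun _ => d) id (z k)

/-- Two tuples in `M ⊕ N` that agree on the sides of their entries, and whose parts lie in the same
members of `F` and of `G`. -/
structure Alike {M : Type w} {N : Type w'} {α : Type*} (c : M) (d : N) (F : Set (Set (α → M)))
    (G : Set (Set (α → N))) (z z' : α → M ⊕ N) : Prop where
  side : ∀ k, (z k).isLeft ↔ (z' k).isLeft
  left : ∀ s ∈ F, leftPart c z ∈ s ↔ leftPart c z' ∈ s
  right : ∀ s ∈ G, rightPart d z ∈ s ↔ rightPart d z' ∈ s

theorem Alike.mono {M : Type w} {N : Type w'} {α : Type*} {c : M} {d : N}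
    {F F' : Set (Set (α → M))} {G G' : Set (Set (α → N))} {z z' : α → M ⊕ N}
    (h : Alike c d F' G' z z') (hF : F ⊆ F') (hG : G ⊆ G') : Alike c d F G z z' :=
  ⟨h.side, fun s hs => h.left s (hF hs), fun s hs => h.right s (hG hs)⟩

/-- A finite family `F` of definable sets of `(k + 1)`-tuples has a finite family of definable sets
of `k`-tuples that determines which traces on `F` are realized by one-point extensions of a tuple,
and the trace of the extension by `c`. -/
theorem exists_finite_definable_extension {L : FirstOrder.Language.{u, v}} {M : Type w}
    [L.Structure M] (c : M) {α β : Type*} [Finite α] [Finite β] (f : α → β) (k₀ : β)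
    {F : Set (Set (β → M))} (hF : F.Finite) (hdef : ∀ s ∈ F, ({c} : Set M).Definable L s) :
    ∃ F' : Set (Set (α → M)), F'.Finite ∧ (∀ s ∈ F', ({c} : Set M).Definable L s) ∧
      ∀ x x' : α → M, (∀ s ∈ F', x ∈ s ↔ x' ∈ s) →
        (∀ y : β → M, y ∘ f = x → ∃ y' : β → M, y' ∘ f = x' ∧ ∀ s ∈ F, y ∈ s ↔ y' ∈ s) ∧
        ∀ s ∈ F, (∃ y ∈ s, y k₀ = c ∧ y ∘ f = x) ↔ ∃ y ∈ s, y k₀ = c ∧ y ∘ f = x' := by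
  have := hF.to_subtype
  -- `E G` collects the tuples whose trace on `F` is `G`; its projection says which tuples have an
  -- extension with that trace.
  let E : Set (Set (β → M)) → Set (β → M) := fun G => {y | ∀ s ∈ F, y ∈ s ↔ s ∈ G}
  have hE : ∀ G, ({c} : Set M).Definable L (E G) := by
    intro G
    have : E G = ⋂ s : F, {y | y ∈ s.1 ↔ s.1 ∈ G} := by
      ext y
      simp [E]
    rw [this]
    refine Set.definable_iInter_of_finite fun s => ?_
    by_cases h : s.1 ∈ G
    · simpa [h] using hdef s.1 s.2
    · simp only [h, iff_false]
      exact (hdef s.1 s.2).compl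
  let pr : Set (β → M) → Set (α → M) := fun s => (fun y => y ∘ f) '' s
  have hc : ({c} : Set M).Definable L {y : β → M | y k₀ = c} :=
    (Set.Definable.singleton L c).preimage_comp (fun _ : Fin 1 => k₀)
  refine ⟨(fun G => pr (E G)) '' F.powerset ∪ (fun s => pr (s ∩ {y | y k₀ = c})) '' F,
    (hF.finite_subsets.image _).union (hF.image _), ?_, fun x x' hx => ⟨fun y hy => ?_,
      fun s hs => ?_⟩⟩
  · rintro _ (⟨G, -, rfl⟩ | ⟨s, hs, rfl⟩)
    · exact (hE G).image_comp f
    · exact ((hdef s hs).inter hc).image_comp f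
  · obtain ⟨y', hy'E, hy'⟩ := (hx (pr (E {s ∈ F | y ∈ s}))
      (Or.inl ⟨_, Set.sep_subset _ _, rfl⟩)).1 ⟨y, fun s hs => by simp [hs], hy⟩
    refine ⟨y', hy', fun s hs => ?_⟩
    rw [hy'E s hs]
    simp [hs]
  · have := hx _ (Or.inr ⟨s, hs, rfl⟩)
    simpa [pr, and_assoc] using this

theorem Alike.symm {M : Type w} {N : Type w'} {α : Type*} {c : M} {d : N}
    {F : Set (Set (α → M))} {G : Set (Set (α → N))} {z z' : α → M ⊕ N}
    (h : Alike c d F G z z') : Alike c d F G z' z :=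
  ⟨fun k => (h.side k).symm, fun s hs => (h.left s hs).symm, fun s hs => (h.right s hs).symm⟩

/-- The tuple `x` with the additional last entry `p`. -/
def snocTuple {P α : Type*} {n : ℕ} (x : α ⊕ Fin n → P) (p : P) : α ⊕ Fin (n + 1) → P :=
  Sum.elim (x ∘ Sum.inl) (Fin.snoc (α := fun _ => P) (x ∘ Sum.inr) p)

theorem snocTuple_comp {P α : Type*} {n : ℕ} (x : α ⊕ Fin n → P) (p : P) :
    snocTuple x p ∘ Sum.map id Fin.castSucc = x := by
  funext k
  cases k <;> simp [snocTuple]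

theorem snocTuple_last {P α : Type*} {n : ℕ} (x : α ⊕ Fin n → P) (p : P) :
    snocTuple x p (Sum.inr (Fin.last n)) = p := by
  simp [snocTuple]

theorem eq_snocTuple {P α : Type*} {n : ℕ} (y : α ⊕ Fin (n + 1) → P) :
    y = snocTuple (y ∘ Sum.map id Fin.castSucc) (y (Sum.inr (Fin.last n))) := by
  funext k
  rcases k with k | k
  · rfl
  · refine Fin.lastCases ?_ (fun k => ?_) k <;> simp [snocTuple]

theorem comp_snocTuple {P Q α : Type*} {n : ℕ} (g : P → Q) (x : α ⊕ Fin n → P) (p : P) :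
    g ∘ snocTuple x p = snocTuple (g ∘ x) (g p) := by
  rw [eq_snocTuple (g ∘ snocTuple x p), Function.comp_assoc, snocTuple_comp, Function.comp_apply,
    snocTuple_last]

theorem leftPart_snocTuple {M : Type w} {N : Type w'} {α : Type*} {n : ℕ} (c : M)
    (z : α ⊕ Fin n → M ⊕ N) (p : M ⊕ N) : leftPart c (snocTuple z p) =
      snocTuple (leftPart c z) (Sum.elim id (fun _ => c) p) :=
  comp_snocTuple _ z p

theorem rightPart_snocTuple {M : Type w} {N : Type w'} {α : Type*} {n : ℕ} (d : N)
    (z : α ⊕ Fin n → M ⊕ N) (p : M ⊕ N) : rightPart d (snocTuple z p) =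
      snocTuple (rightPart d z) (Sum.elim (fun _ => d) id p) :=
  comp_snocTuple _ z p

theorem snocTuple_mem_iff {P α : Type*} {n : ℕ} (s : Set (α ⊕ Fin (n + 1) → P))
    (x : α ⊕ Fin n → P) (p : P) : snocTuple x p ∈ s ↔
      ∃ y ∈ s, y (Sum.inr (Fin.last n)) = p ∧ y ∘ Sum.map id Fin.castSucc = x := by
  constructor
  · exact fun h => ⟨_, h, snocTuple_last x p, snocTuple_comp x p⟩
  · rintro ⟨y, hy, rfl, rfl⟩
    rwa [← eq_snocTuple]

theorem FirstOrder.Language.Term.exists_eq_var {L : FirstOrder.Language.{u, v}} [L.IsRelational]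
    {α : Type*} (t : L.Term α) : ∃ k, t = Term.var k := by
  cases t with
  | var k => exact ⟨k, rfl⟩
  | func f _ => exact isEmptyElim f

instance : sideLanguage.IsRelational := fun _ => inferInstanceAs (IsEmpty Empty)

theorem definable_relMap {L : FirstOrder.Language.{u, v}} {M : Type w} [L.Structure M] (A : Set M)
    {α : Type*} {l : ℕ} (S : L.Relations l) (a : Fin l → α) :
    A.Definable L {y : α → M | Structure.RelMap S (y ∘ a)} := by
  refine Set.Definable.mono (Set.empty_definable_iff.2
    ⟨S.formula fun k => Term.var (a k), ?_⟩) (Set.empty_subset A)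
  ext y
  simp [Formula.realize_rel, Function.comp_def]

theorem definable_eq {L : FirstOrder.Language.{u, v}} {M : Type w} [L.Structure M] (A : Set M)
    {α : Type*} (k l : α) : A.Definable L {y : α → M | y k = y l} := by
  refine Set.Definable.mono (Set.empty_definable_iff.2
    ⟨(Term.var k).equal (Term.var l), ?_⟩) (Set.empty_subset A)
  ext y
  simp [Formula.realize_equal]

/-- The sides must be compared as well: `Sum.inl c` and `Sum.inr d` have equal parts. -/
theorem eq_iff_parts {M : Type w} {N : Type w'} {α : Type*} (c : M) (d : N) (z : α → M ⊕ N)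
    (k l : α) : z k = z l ↔ ((z k).isLeft ↔ (z l).isLeft) ∧
      leftPart c z k = leftPart c z l ∧ rightPart d z k = rightPart d z l := by
  unfold leftPart rightPart
  rcases z k with x | x <;> rcases z l with y | y <;> simp

theorem relMap_sum_iff {M : Type w} {N : Type w'} [τ.Structure M] [τ.Structure N] (c : M) (d : N)
    {α : Type*} {l : ℕ} (S : τ.Relations l) (z : α → M ⊕ N) (a : Fin l → α) :
    Structure.RelMap S (z ∘ a) ↔
      ((∀ k, (z (a k)).isLeft) ∧ Structure.RelMap S (leftPart c z ∘ a)) ∨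
      ((∀ k, ¬ (z (a k)).isLeft) ∧ Structure.RelMap S (rightPart d z ∘ a)) := by
  refine or_congr ⟨?_, ?_⟩ ⟨?_, ?_⟩
  · rintro ⟨x, hx, hS⟩
    have hx' : ∀ k, z (a k) = Sum.inl (x k) := congrFun hx
    refine ⟨fun k => by simp [hx'], ?_⟩
    convert hS
    funext k
    simp [leftPart, hx']
  · rintro ⟨h, hS⟩
    refine ⟨_, funext fun k => ?_, hS⟩
    obtain ⟨y, hy⟩ := Sum.isLeft_iff.1 (h k)
    simp [leftPart, hy]
  · rintro ⟨x, hx, hS⟩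
    have hx' : ∀ k, z (a k) = Sum.inr (x k) := congrFun hx
    refine ⟨fun k => by simp [hx'], ?_⟩
    convert hS
    funext k
    simp [rightPart, hx']
  · rintro ⟨h, hS⟩
    refine ⟨_, funext fun k => ?_, hS⟩
    obtain ⟨y, hy⟩ := Sum.isRight_iff.1 (Sum.not_isLeft.1 (h k))
    simp [rightPart, hy]

/-- **Feferman–Vaught** for disjoint sums: the truth of a formula is determined by the sides of the
free variables and finitely many definable properties of either part. -/
theorem exists_alike_realize_iff (M : Type w) (N : Type w') [τ.Structure M] [τ.Structure N]
    (c : M) (d : N) {α : Type} [Finite α] {n : ℕ}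
    (φ : (τ.sum sideLanguage).BoundedFormula α n) :
    ∃ (F : Set (Set (α ⊕ Fin n → M))) (G : Set (Set (α ⊕ Fin n → N))), F.Finite ∧ G.Finite ∧
      (∀ s ∈ F, ({c} : Set M).Definable τ s) ∧ (∀ s ∈ G, ({d} : Set N).Definable τ s) ∧
      ∀ z z' : α ⊕ Fin n → M ⊕ N, Alike c d F G z z' →
        (φ.Realize (z ∘ Sum.inl) (z ∘ Sum.inr) ↔ φ.Realize (z' ∘ Sum.inl) (z' ∘ Sum.inr)) := by
  induction φ with
  | falsum => exact ⟨∅, ∅, Set.finite_empty, Set.finite_empty, by simp, by simp, fun _ _ _ => Iff.rfl⟩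
  | @equal n t₁ t₂ =>
    obtain ⟨k, rfl⟩ := t₁.exists_eq_var
    obtain ⟨l, rfl⟩ := t₂.exists_eq_var
    refine ⟨{{y | y k = y l}}, {{y | y k = y l}}, Set.finite_singleton _, Set.finite_singleton _,
      ?_, ?_, fun z z' h => ?_⟩
    · rintro s rfl
      exact definable_eq _ k l
    · rintro s rfl
      exact definable_eq _ k l
    · have h1 := h.left _ rfl
      have h2 := h.right _ rfl
      simp only [Set.mem_ofPred_eq] at h1 h2
      simp only [BoundedFormula.Realize, Sum.elim_comp_inl_inr, Term.realize_var]
      rw [eq_iff_parts c d z, eq_iff_parts c d z', h1, h2, h.side k, h.side l]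
  | @rel n l R ts =>
    choose a ha using fun k => (ts k).exists_eq_var
    obtain rfl : ts = fun k => Term.var (a k) := funext ha
    rcases R with S | S
    · refine ⟨{{y | Structure.RelMap S (y ∘ a)}}, {{y | Structure.RelMap S (y ∘ a)}},
        Set.finite_singleton _, Set.finite_singleton _, ?_, ?_, fun z z' h => ?_⟩
      · rintro s rfl
        exact definable_relMap _ S a
      · rintro s rfl
        exact definable_relMap _ S a
      · have h1 := h.left _ rfl
        have h2 := h.right _ rfl
        simp only [Set.mem_ofPred_eq] at h1 h2
        simp only [BoundedFormula.Realize, Sum.elim_comp_inl_inr, Term.realize_var]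
        change Structure.RelMap S (z ∘ a) ↔ Structure.RelMap S (z' ∘ a)
        rw [relMap_sum_iff c d, relMap_sum_iff c d, h1, h2]
        simp only [h.side]
    · refine ⟨∅, ∅, Set.finite_empty, Set.finite_empty, by simp, by simp, fun z z' h => ?_⟩
      simp only [BoundedFormula.Realize, Sum.elim_comp_inl_inr, Term.realize_var]
      have h0 := fun k => h.side (a k)
      cases S with
      | left =>
        change (∃ x : M, z (a 0) = Sum.inl x) ↔ ∃ x : M, z' (a 0) = Sum.inl x
        rw [← Sum.isLeft_iff, ← Sum.isLeft_iff]
        exact h0 0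
      | right =>
        change (∃ x : N, z (a 0) = Sum.inr x) ↔ ∃ x : N, z' (a 0) = Sum.inr x
        rw [← Sum.isRight_iff, ← Sum.isRight_iff, ← Sum.not_isLeft, ← Sum.not_isLeft]
        exact not_congr (h0 0)
  | imp φ ψ ihφ ihψ =>
    obtain ⟨F, G, hF, hG, hFd, hGd, h⟩ := ihφ
    obtain ⟨F', G', hF', hG', hFd', hGd', h'⟩ := ihψ
    refine ⟨F ∪ F', G ∪ G', hF.union hF', hG.union hG', ?_, ?_, fun z z' hz => ?_⟩
    · rintro s (hs | hs)
      exacts [hFd s hs, hFd' s hs]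
    · rintro s (hs | hs)
      exacts [hGd s hs, hGd' s hs]
    · rw [BoundedFormula.realize_imp, BoundedFormula.realize_imp,
        h z z' (hz.mono Set.subset_union_left Set.subset_union_left),
        h' z z' (hz.mono Set.subset_union_right Set.subset_union_right)]
  | @all n φ ih =>
    obtain ⟨F, G, hF, hG, hFd, hGd, h⟩ := ih
    obtain ⟨F', hF', hFd', hFe⟩ := exists_finite_definable_extension c
      (Sum.map id Fin.castSucc) (Sum.inr (Fin.last n)) hF hFd
    obtain ⟨G', hG', hGd', hGe⟩ := exists_finite_definable_extension d
      (Sum.map id Fin.castSucc) (Sum.inr (Fin.last n)) hG hGd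
    refine ⟨F', G', hF', hG', hFd', hGd', ?_⟩
    have hext : ∀ z z' : α ⊕ Fin n → M ⊕ N, Alike c d F' G' z z' → ∀ p, ∃ p',
        Alike c d F G (snocTuple z p) (snocTuple z' p') := by
      intro z z' hz p
      have hside : ∀ p', (p.isLeft ↔ p'.isLeft) → ∀ k,
          ((snocTuple z p k).isLeft ↔ (snocTuple z' p' k).isLeft) := by
        rintro p' hp (k | k)
        · exact hz.side (Sum.inl k)
        · refine Fin.lastCases ?_ (fun k => ?_) k
          · rwa [snocTuple_last, snocTuple_last]
          · simpa [snocTuple] using hz.side (Sum.inr k)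
      rcases p with p | p
      · obtain ⟨y, hy, hyF⟩ := (hFe _ _ hz.left).1 (snocTuple (leftPart c z) p)
          (snocTuple_comp _ _)
        refine ⟨Sum.inl (y (Sum.inr (Fin.last n))), hside _ (by simp), fun s hs => ?_,
          fun s hs => ?_⟩
        · rw [leftPart_snocTuple, leftPart_snocTuple, ← hy]
          simp only [Sum.elim_inl, id_eq]
          rw [← eq_snocTuple]
          exact hyF s hs
        · rw [rightPart_snocTuple, rightPart_snocTuple, snocTuple_mem_iff, snocTuple_mem_iff]
          exact (hGe _ _ hz.right).2 s hs
      · obtain ⟨y, hy, hyG⟩ := (hGe _ _ hz.right).1 (snocTuple (rightPart d z) p)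
          (snocTuple_comp _ _)
        refine ⟨Sum.inr (y (Sum.inr (Fin.last n))), hside _ (by simp), fun s hs => ?_,
          fun s hs => ?_⟩
        · rw [leftPart_snocTuple, leftPart_snocTuple, snocTuple_mem_iff, snocTuple_mem_iff]
          exact (hFe _ _ hz.left).2 s hs
        · rw [rightPart_snocTuple, rightPart_snocTuple, ← hy]
          simp only [Sum.elim_inr, id_eq]
          rw [← eq_snocTuple]
          exact hyG s hs
    have himp : ∀ z z' : α ⊕ Fin n → M ⊕ N, Alike c d F' G' z z' →
        φ.all.Realize (z ∘ Sum.inl) (z ∘ Sum.inr) → φ.all.Realize (z' ∘ Sum.inl) (z' ∘ Sum.inr) := by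
      intro z z' hz hφ p'
      obtain ⟨p, hp⟩ := hext z' z hz.symm p'
      exact (h _ _ hp).2 (hφ p)
    exact fun z z' hz => ⟨himp z z' hz, himp z' z hz.symm⟩

/-- `exists_alike_realize_iff` for formulas without bound variables in scope. -/
theorem exists_alike_formula_realize_iff (M : Type w) (N : Type w') [τ.Structure M]
    [τ.Structure N] (c : M) (d : N) {α : Type} [Finite α] (φ : (τ.sum sideLanguage).Formula α) :
    ∃ (F : Set (Set (α → M))) (G : Set (Set (α → N))), F.Finite ∧ G.Finite ∧
      (∀ s ∈ F, ({c} : Set M).Definable τ s) ∧ (∀ s ∈ G, ({d} : Set N).Definable τ s) ∧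
      ∀ z z' : α → M ⊕ N, Alike c d F G z z' → (φ.Realize z ↔ φ.Realize z') := by
  obtain ⟨F, G, hF, hG, hFd, hGd, h⟩ := exists_alike_realize_iff M N c d φ
  let e : α ⊕ Fin 0 → α := Sum.elim id Fin.elim0
  refine ⟨(fun s => {y | y ∘ e ∈ s}) '' F, (fun s => {y | y ∘ e ∈ s}) '' G, hF.image _, hG.image _,
    ?_, ?_, fun z z' hz => ?_⟩
  · rintro _ ⟨s, hs, rfl⟩
    exact (hFd s hs).preimage_comp e
  · rintro _ ⟨s, hs, rfl⟩
    exact (hGd s hs).preimage_comp e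
  · have := h (z ∘ e) (z' ∘ e) ⟨fun k => hz.side (e k),
      fun s hs => hz.left _ ⟨s, hs, rfl⟩, fun s hs => hz.right _ ⟨s, hs, rfl⟩⟩
    rw [Subsingleton.elim ((z ∘ e) ∘ Sum.inr) default,
      Subsingleton.elim ((z' ∘ e) ∘ Sum.inr) default] at this
    exact this

end Sum

/-! ### Transfer of a pattern to one summand -/

section Main

open FirstOrder FirstOrder.Language

theorem HasFinitePatterns.map {X X' : Type*} {Y Y' : ℕ → Type*} {R : ∀ i, X → Y i → Prop}
    {R' : ∀ i, X' → Y' i → Prop} (h : HasFinitePatterns R) (f : X → X') (g : ∀ i, Y i → Y' i)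
    (hR : ∀ i x y, R i x y ↔ R' i (f x) (g i y)) : HasFinitePatterns R' := by
  intro n q
  obtain ⟨b, hb⟩ := h n q
  refine ⟨fun i j => g i (b i j), fun η hη => ?_⟩
  obtain ⟨a, ha⟩ := hb η hη
  exact ⟨f a, fun i hi j hj => (hR i a (b i j)).symm.trans (ha i hi j hj)⟩

theorem not_hasFinitePatterns_of_forall_not {X : Type*} {Y : ℕ → Type*} {R : ∀ i, X → Y i → Prop}
    (i : ℕ) (hi : ∀ x y, ¬ R i x y) : ¬ HasFinitePatterns R := by
  intro h
  obtain ⟨b, hb⟩ := h (i + 1) 1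
  obtain ⟨a, ha⟩ := hb (fun _ => 0) fun _ _ => one_pos
  exact hi _ _ ((ha i i.lt_succ_self 0 one_pos).2 rfl)

theorem not_hasFinitePatterns_of_forall_iff {X : Type*} {Y : ℕ → Type*} {R : ∀ i, X → Y i → Prop}
    (i : ℕ) (hi : ∀ x x' y, R i x y → R i x' y) : ¬ HasFinitePatterns R := by
  intro h
  obtain ⟨b, hb⟩ := h (i + 1) 2
  obtain ⟨a, ha⟩ := hb (fun _ => 0) fun _ _ => two_pos
  obtain ⟨a', ha'⟩ := hb (fun _ => 1) fun _ _ => one_lt_two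
  exact one_ne_zero ((ha' i i.lt_succ_self 0 two_pos).1
    (hi a a' _ ((ha i i.lt_succ_self 0 two_pos).2 rfl)))

/-- Finite patterns for changes of definable relations yield `κ^ict > ℵ₀`. -/
theorem kappaIctGT_of_definable {L : FirstOrder.Language.{u, v}} {M : Type w} [L.Structure M]
    (c : M) {m : ℕ} {n : ℕ → ℕ} (s : ∀ i, Set (Fin m ⊕ Fin (n i) → M))
    (hs : ∀ i, ({c} : Set M).Definable L (s i))
    (h : HasFinitePatterns fun i =>
      differ fun (x : Fin m → M) (y : Fin (n i) → M) => Sum.elim x y ∈ s i) :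
    KappaIctGT (L.completeTheory M) Cardinal.aleph0.{0} := by
  have : Nonempty M := ⟨c⟩
  choose θ hθ using fun i => Set.definable_iff_exists_formula_sum.1 (hs i)
  -- The new parameter tuple consists of both members of a pair followed by `c`, which turns the
  -- fixed parameter into a variable.
  let e := fun i => Fintype.equivFin (Fin (n i) ⊕ Fin (n i) ⊕ Unit)
  let sub : ∀ i, (Fin (n i) → Fin (n i) ⊕ Fin (n i) ⊕ Unit) →
      L.Formula (Fin m ⊕ Fin (Fintype.card (Fin (n i) ⊕ Fin (n i) ⊕ Unit))) := fun i f =>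
    (θ i).relabel (Sum.elim (fun _ => Sum.inr (e i (Sum.inr (Sum.inr ()))))
      (Sum.map id fun k => e i (f k)))
  let g : ∀ i, (Fin (n i) → M) × (Fin (n i) → M) →
      Fin (Fintype.card (Fin (n i) ⊕ Fin (n i) ⊕ Unit)) → M := fun i y k =>
    Sum.elim y.1 (Sum.elim y.2 fun _ => c) ((e i).symm k)
  have hsub : ∀ i f x y, (sub i f).Realize (Sum.elim x (g i y)) ↔
      Sum.elim x (fun k => Sum.elim y.1 (Sum.elim y.2 fun _ => c) (f k)) ∈ s i := by
    intro i f x y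
    rw [hθ, Set.mem_ofPred_eq, Formula.realize_relabel]
    refine iff_of_eq (congrArg _ (funext fun k => ?_))
    rcases k with k | k | k
    · simpa [g] using k.2.symm
    · rfl
    · simp [g]
  refine kappaIctGT_of_hasFinitePatterns
    (φ := fun i => ((sub i Sum.inl).iff (sub i fun k => Sum.inr (Sum.inl k))).not)
    (h.map id g fun i x y => ?_)
  rw [Formula.realize_not, Formula.realize_iff, id_eq, hsub, hsub]
  rfl

theorem leftPart_elim {M : Type w} {N : Type w'} {α β : Type*} (c : M) (x : α → M ⊕ N)
    (y : β → M ⊕ N) : leftPart c (Sum.elim x y) = Sum.elim (leftPart c x) (leftPart c y) := by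
  funext k
  cases k <;> rfl

theorem rightPart_elim {M : Type w} {N : Type w'} {α β : Type*} (d : N) (x : α → M ⊕ N)
    (y : β → M ⊕ N) : rightPart d (Sum.elim x y) = Sum.elim (rightPart d x) (rightPart d y) := by
  funext k
  cases k <;> rfl

theorem kappaIctGT_or_of_theoryOfSum {τ : FirstOrder.Language.{u, v}} [τ.IsRelational]
    {M : Type w} {N : Type w'} [τ.Structure M] [τ.Structure N] [Nonempty M] [Nonempty N]
    (h : KappaIctGT (theoryOfSum τ M N) Cardinal.aleph0.{0}) :
    KappaIctGT (τ.completeTheory M) Cardinal.aleph0.{0} ∨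
      KappaIctGT (τ.completeTheory N) Cardinal.aleph0.{0} := by
  obtain ⟨c⟩ := ‹Nonempty M›
  obtain ⟨d⟩ := ‹Nonempty N›
  have : Nonempty (M ⊕ N) := ⟨Sum.inl c⟩
  obtain ⟨m, n, φ, hφ⟩ := hasFinitePatterns_of_kappaIctGT h
  choose F G hF hG hFd hGd hFG using fun i => exists_alike_formula_realize_iff M N c d (φ i)
  have := fun i => (hF i).to_subtype
  have := fun i => (hG i).to_subtype
  let O : ℕ → Type max w w' := fun i => (Fin m ⊕ Fin (n i)) ⊕ F i ⊕ G i
  let P : ∀ i, O i → (Fin m → M ⊕ N) → (Fin (n i) → M ⊕ N) → Prop := fun i o x y =>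
    Sum.elim (fun k => ((Sum.elim x y k).isLeft : Prop))
      (Sum.elim (fun s => leftPart c (Sum.elim x y) ∈ s.1)
        fun s => rightPart d (Sum.elim x y) ∈ s.1) o
  have hP : ∀ i x x' y y', (∀ o, P i o x y ↔ P i o x' y') →
      ((φ i).Realize (Sum.elim x y) ↔ (φ i).Realize (Sum.elim x' y')) := fun i x x' y y' ho =>
    hFG i _ _ ⟨fun k => ho (Sum.inl k), fun s hs => ho (Sum.inr (Sum.inl ⟨s, hs⟩)),
      fun s hs => ho (Sum.inr (Sum.inr ⟨s, hs⟩))⟩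
  -- With no constituents at all, `φ i` would have a constant truth value.
  have hO : ∀ i, Nonempty (O i) := by
    intro i
    by_contra hemp
    rw [not_nonempty_iff] at hemp
    refine not_hasFinitePatterns_of_forall_iff i (fun x x' y => ?_) hφ
    exact (hP i x x' y y fun o => isEmptyElim o).1
  have hOf : ∀ i, Finite (O i) := fun i => by
    dsimp only [O]
    infer_instance
  obtain ⟨o, ho⟩ := hφ.exists_differ P _ hP
  -- The side of an entry of `x` never changes within a pair, and a change in the side of an entry
  -- of `y` does not depend on `x`; a row of a pattern allows neither.
  have hcases : ∀ i, (∃ s, o i = Sum.inr (Sum.inl s)) ∨ ∃ s, o i = Sum.inr (Sum.inr s) := by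
    intro i
    rcases hoi : o i with (k | k) | s | s
    · refine absurd ho (not_hasFinitePatterns_of_forall_not i fun x y => ?_)
      simp [differ, P, hoi]
    · refine absurd ho (not_hasFinitePatterns_of_forall_iff i fun x x' y => ?_)
      simp [differ, P, hoi]
    · exact Or.inl ⟨s, rfl⟩
    · exact Or.inr ⟨s, rfl⟩
  have hinf : ({i | ∃ s, o i = Sum.inr (Sum.inl s)} ∪
      {i | ∃ s, o i = Sum.inr (Sum.inr s)} : Set ℕ).Infinite :=
    Set.infinite_univ.mono fun i _ => hcases i
  rcases Set.infinite_union.1 hinf with hI | hI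
  · left
    choose s hs using fun k => (hI.natEmbedding _ k).2
    refine kappaIctGT_of_definable c (fun k => (s k).1) (fun k => hFd _ _ (s k).2)
      ((ho.comp_injective (Subtype.val_injective.comp (hI.natEmbedding _).injective)).map
        (leftPart c) (fun _ y => (leftPart c y.1, leftPart c y.2)) fun k x y => ?_)
    simp only [Function.comp_apply, hs, P, differ, Sum.elim_inr, Sum.elim_inl, leftPart_elim]
  · right
    choose s hs using fun k => (hI.natEmbedding _ k).2
    refine kappaIctGT_of_definable d (fun k => (s k).1) (fun k => hGd _ _ (s k).2)
      ((ho.comp_injective (Subtype.val_injective.comp (hI.natEmbedding _).injective)).map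
        (rightPart d) (fun _ y => (rightPart d y.1, rightPart d y.2)) fun k x y => ?_)
    simp only [Function.comp_apply, hs, P, differ, Sum.elim_inr, rightPart_elim]

end Main

theorem mainTheorem4 (τ : FirstOrder.Language.{u, v}) [τ.IsRelational]
    (M₁ : Type w) (M₂ : Type w') [τ.Structure M₁] [τ.Structure M₂]
    (h₁ : StronglyDependentOne (τ.completeTheory M₁))
    (h₂ : StronglyDependentOne (τ.completeTheory M₂)) :
    StronglyDependentOne (theoryOfSum τ M₁ M₂) := by
  have : Infinite M₁ := infinite_of_kappaIctGT_one (h₁.1 1 Cardinal.one_lt_aleph0)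
  have : Infinite M₂ := infinite_of_kappaIctGT_one (h₂.1 1 Cardinal.one_lt_aleph0)
  exact ⟨fun μ hμ => kappaIctGT_of_infinite hμ,
    fun h => (kappaIctGT_or_of_theoryOfSum h).elim h₁.2 h₂.2⟩
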